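/- Let $d\in\mathbb{N}$, let $\tilde\Gamma$ be a discrete group with a finite generating family $\tilde S=(\tilde s_1,\dots,\tilde s_d)$, and let $\varphi:\tilde\Gamma\to\Gamma$ and $\varphi_n:\tilde\Gamma\to\Gamma_n$ ($n\ge 1$) be surjective group homomorphisms. Let $S=\varphi(\tilde S)$ and $S_n=\varphi_n(\tilde S)$ be the image families of generators of $\Gamma$ and $\Gamma_n$. Let $X_d$ be the space of marked groups on $d$ generators, i.e. of isomorphism classes $[G,T]$ of groups $G$ with a generating family $T=(t_1,\dots,t_d)$, with the metric $d([G,T],[G',T'])=2^{-N}$, where $N\le\infty$ is the largest radius such that the balls of radius $N$ around the origin in the Cayley graphs of $(G,T)$ and $(G',T')$ are isomorphic as oriented, labelled graphs, by an isomorphism that preserves the origin ($N=0$ if there is no such radius). For a discrete group $G$ let $L^1(G)$ be the convolution algebra of formal series $\sum_{g} f_g\, g$ with $\sum_g|f_g|<\infty$; a homomorphism $\psi:G\to G'$ induces $\psi_*:L^1(G)\to L^1(G')$, $\psi_*(\sum_g f_g\, g)=\sum_g f_g\,\psi(g)$. Let $\mathcal{N}G$ be the von Neumann algebra of all left $G$-equivariant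 bounded operators on $L^2(G)$, with trace $\tau_{\mathcal{N}G}(A)=(Ae,e)$, and view $L^1(G)$ as a subalgebra of $\mathcal{N}G$ via $\sum_g f_g\, g\mapsto\sum_g f_g R_{g^{-1}}$, where $R_g(x)=xg$. The Fuglede–Kadison determinant is $\det_{\mathcal{N}G}A=\exp\tau_{\mathcal{N}G}(\log|A|)$ for invertible $A\in\mathcal{N}G$, and $\det_{\mathcal{N}G}A=\lim_{\varepsilon\to0+}\det_{\mathcal{N}G}(|A|+\varepsilon)$ in general. Suppose that $[\Gamma_n,S_n]\to[\Gamma,S]$ in $X_d$ as $n\to\infty$. For $\tilde f\in L^1(\tilde\Gamma)$ put $f=\varphi_*(\tilde f)\in L^1(\Gamma)$ and $f_n=\varphi_{n*}(\tilde f)\in L^1(\Gamma_n)$. Then: (a) $\lim_{n\to\infty}\tau_{\mathcal{N}\Gamma_n}(f_n)=\tau_{\mathcal{N}\Gamma}(f)$ for every $\tilde f\in L^1(\tilde\Gamma)$. (b) If $\tilde f$ is invertible in $L^1(\tilde\Gamma)$, then $\lim_{n\to\infty}\det_{\mathcal{N}\Gamma_n}(f_n)=\det_{\mathcal{N}\Gamma}(f)$.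 -/

import Mathlib

open Filter Topology

universe u v

/-! ## The space of marked groups on `d` generators -/

/-- A group together with a family `s_1, …, s_d` of generators (repetitions allowed). -/
structure MarkedGroup (d : ℕ) : Type (u + 1) where
  /-- the underlying group -/
  carrier : Type u
  /-- the group structure -/
  [group : Group carrier]
  /-- the family of generators -/
  gen : Fin d → carrier
  /-- the family generates the group -/
  closure_gen : Subgroup.closure (Set.range gen) = ⊤

namespace MarkedGroup

attribute [instance] MarkedGroup.group

variable {d : ℕ}

/-- Evaluation of an `S`-word, i.e. a finite string of generators (`true`) and inverses of
generators (`false`). -/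
def ev (M : MarkedGroup.{u} d) (w : List (Fin d × Bool)) : M.carrier :=
  (w.map fun x => cond x.2 (M.gen x.1) (M.gen x.1)⁻¹).prod

/-- Vertices of the ball of radius `N` around the origin in the Cayley graph: the elements that
can be written as a word of length at most `N`. -/
def ball (M : MarkedGroup.{u} d) (N : ℕ) : Set M.carrier :=
  {g | ∃ w : List (Fin d × Bool), w.length ≤ N ∧ M.ev w = g}

/-- The Cayley graph has an oriented edge with label `i` from `x` to `x * s_i`. -/
def Edge (M : MarkedGroup.{u} d) (i : Fin d) (x y : M.carrier) : Prop :=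
  y = x * M.gen i

theorem one_mem_ball (M : MarkedGroup.{u} d) (N : ℕ) : (1 : M.carrier) ∈ M.ball N :=
  ⟨[], Nat.zero_le _, by simp [ev]⟩

/-- The balls of radius `N` around the origin in the two Cayley graphs are isomorphic as oriented
labelled graphs (with the origin as base point). -/
def BallIso (M M' : MarkedGroup.{u} d) (N : ℕ) : Prop :=
  ∃ e : M.ball N ≃ M'.ball N,
    e ⟨1, M.one_mem_ball N⟩ = ⟨1, M'.one_mem_ball N⟩ ∧
    ∀ (i : Fin d) (x y : M.ball N), M.Edge i x y ↔ M'.Edge i (e x) (e y)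

/-- The largest radius `N ≤ ∞` for which the balls around the origin are isomorphic. -/
noncomputable def radius (M M' : MarkedGroup.{u} d) : ℕ∞ :=
  ⨆ (N : ℕ) (_ : BallIso M M' N), (N : ℕ∞)

/-- Two marked groups are isomorphic if some group isomorphism matches the generators. -/
def Iso (M M' : MarkedGroup.{u} d) : Prop :=
  ∃ α : M.carrier ≃* M'.carrier, ∀ i, α (M.gen i) = M'.gen i

/-- `2 ^ (-N)` for `N ≤ ∞`. -/
noncomputable def twoPowNeg (N : ℕ∞) : ℝ :=
  if N = ⊤ then 0 else (1 / 2 : ℝ) ^ N.toNat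

/-! Facts needed to see that `2 ^ (-radius)` is a metric on isomorphism classes. -/

theorem ev_append (M : MarkedGroup.{u} d) (w w' : List (Fin d × Bool)) :
    M.ev (w ++ w') = M.ev w * M.ev w' := by
  simp [ev]

/-- The isomorphism of balls expressed through words. -/
def Agree (M M' : MarkedGroup.{u} d) (N : ℕ) : Prop :=
  ∀ w w' : List (Fin d × Bool), w.length ≤ N → w'.length ≤ N →
    (M.ev w = M.ev w' ↔ M'.ev w = M'.ev w') ∧
    ∀ i, M.Edge i (M.ev w) (M.ev w') ↔ M'.Edge i (M'.ev w) (M'.ev w')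

theorem ballIso_iff_agree (M M' : MarkedGroup.{u} d) (N : ℕ) :
    BallIso M M' N ↔ Agree M M' N := by
  constructor
  · rintro ⟨e, he1, he⟩
    have key : ∀ (w : List (Fin d × Bool)) (hw : w.length ≤ N),
        e ⟨M.ev w, w, hw, rfl⟩ = ⟨M'.ev w, w, hw, rfl⟩ := by
      intro w
      induction w using List.reverseRecOn with
      | nil =>
        intro hw
        have h1 : (⟨M.ev [], [], hw, rfl⟩ : M.ball N) = ⟨1, M.one_mem_ball N⟩ :=
          Subtype.ext (by simp [ev])
        rw [h1, he1]
        exact Subtype.ext (by simp [ev])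
      | append_singleton w x ih =>
        intro hw
        have hw0 : w.length ≤ N := by simp at hw; omega
        have ih' := ih hw0
        obtain ⟨i, b⟩ := x
        apply Subtype.ext
        cases b with
        | true =>
          have h := (he i ⟨M.ev w, w, hw0, rfl⟩ ⟨M.ev (w ++ [(i, true)]), _, hw, rfl⟩).1
            (by simp [Edge, ev])
          rw [ih'] at h
          simp only [Edge] at h
          rw [h]
          simp [ev]
        | false =>
          have h := (he i ⟨M.ev (w ++ [(i, false)]), _, hw, rfl⟩ ⟨M.ev w, w, hw0, rfl⟩).1
            (by simp [Edge, ev])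
          rw [ih'] at h
          simp only [Edge] at h
          have h2 : M'.ev (w ++ [(i, false)]) = M'.ev w * (M'.gen i)⁻¹ := by simp [ev]
          refine Eq.trans ?_ h2.symm
          rw [h, mul_inv_cancel_right]
    intro w w' hw hw'
    refine ⟨?_, fun i => ?_⟩
    · have h1 : M.ev w = M.ev w' ↔
          (⟨M.ev w, w, hw, rfl⟩ : M.ball N) = ⟨M.ev w', w', hw', rfl⟩ := Subtype.mk_eq_mk.symm
      rw [h1, ← e.injective.eq_iff, key w hw, key w' hw']
      exact Subtype.mk_eq_mk
    · have h := he i ⟨M.ev w, w, hw, rfl⟩ ⟨M.ev w', w', hw', rfl⟩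
      rw [key w hw, key w' hw'] at h
      exact h
  · intro h
    have hc : ∀ x : M.ball N, ∃ w : List (Fin d × Bool), w.length ≤ N ∧ M.ev w = x :=
      fun x => x.2
    choose wd hl hwd using hc
    let f : M.ball N → M'.ball N := fun x => ⟨M'.ev (wd x), wd x, hl x, rfl⟩
    have hf : ∀ (w : List (Fin d × Bool)) (hw : w.length ≤ N),
        f ⟨M.ev w, w, hw, rfl⟩ = ⟨M'.ev w, w, hw, rfl⟩ := by
      intro w hw
      exact Subtype.ext (((h _ w (hl _) hw).1).1 (hwd _))
    have hbij : Function.Bijective f := by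
      constructor
      · intro x y hxy
        have h1 := ((h (wd x) (wd y) (hl x) (hl y)).1).2 (congrArg Subtype.val hxy)
        rw [hwd, hwd] at h1
        exact Subtype.ext h1
      · rintro ⟨y, w, hw, rfl⟩
        exact ⟨⟨M.ev w, w, hw, rfl⟩, hf w hw⟩
    refine ⟨Equiv.ofBijective f hbij, ?_, ?_⟩
    · have h1 := hf [] (Nat.zero_le _)
      simpa [ev] using h1
    · intro i x y
      have h1 := (h (wd x) (wd y) (hl x) (hl y)).2 i
      rw [hwd, hwd] at h1
      exact h1

theorem Agree.mono {M M' : MarkedGroup.{u} d} {N k : ℕ} (h : Agree M M' N) (hk : k ≤ N) :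
    Agree M M' k :=
  fun w w' hw hw' => h w w' (hw.trans hk) (hw'.trans hk)

theorem Agree.symm {M M' : MarkedGroup.{u} d} {N : ℕ} (h : Agree M M' N) : Agree M' M N :=
  fun w w' hw hw' => ⟨((h w w' hw hw').1).symm, fun i => ((h w w' hw hw').2 i).symm⟩

theorem Agree.trans {M M' M'' : MarkedGroup.{u} d} {N : ℕ} (h : Agree M M' N)
    (h' : Agree M' M'' N) : Agree M M'' N :=
  fun w w' hw hw' => ⟨((h w w' hw hw').1).trans (h' w w' hw hw').1,
    fun i => ((h w w' hw hw').2 i).trans ((h' w w' hw hw').2 i)⟩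

theorem Iso.agree {M M' : MarkedGroup.{u} d} (h : Iso M M') (N : ℕ) : Agree M M' N := by
  obtain ⟨α, hα⟩ := h
  have hev : ∀ w, α (M.ev w) = M'.ev w := by
    intro w
    simp only [ev, map_list_prod, List.map_map]
    congr 1
    apply List.map_congr_left
    rintro ⟨i, b⟩ -
    cases b <;> simp [hα]
  intro w w' _ _
  refine ⟨by rw [← hev, ← hev, α.injective.eq_iff], fun i => ?_⟩
  simp only [Edge]
  rw [← hev, ← hev, ← hα, ← map_mul, α.injective.eq_iff]

theorem Iso.refl (M : MarkedGroup.{u} d) : Iso M M := ⟨MulEquiv.refl _, fun _ => rfl⟩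

theorem Iso.symm {M M' : MarkedGroup.{u} d} (h : Iso M M') : Iso M' M := by
  obtain ⟨α, hα⟩ := h
  exact ⟨α.symm, fun i => by rw [← hα, MulEquiv.symm_apply_apply]⟩

theorem Iso.trans {M M' M'' : MarkedGroup.{u} d} (h : Iso M M') (h' : Iso M' M'') :
    Iso M M'' := by
  obtain ⟨α, hα⟩ := h
  obtain ⟨β, hβ⟩ := h'
  exact ⟨α.trans β, fun i => by simp [hα, hβ]⟩

theorem iso_of_agree {M M' : MarkedGroup.{u} d} (h : ∀ N, Agree M M' N) : Iso M M' := by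
  have hlift : ∀ (P : MarkedGroup.{u} d) (w : List (Fin d × Bool)),
      FreeGroup.lift P.gen (FreeGroup.mk w) = P.ev w := fun P w => FreeGroup.lift_mk
  have hsurj : ∀ P : MarkedGroup.{u} d, Function.Surjective (FreeGroup.lift P.gen) := by
    intro P
    rw [← MonoidHom.range_eq_top, FreeGroup.range_lift_eq_closure, P.closure_gen]
  have hker : (FreeGroup.lift M.gen).ker = (FreeGroup.lift M'.gen).ker := by
    ext x
    obtain ⟨w, rfl⟩ : ∃ w, FreeGroup.mk w = x := ⟨x.toWord, FreeGroup.mk_toWord⟩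
    rw [MonoidHom.mem_ker, MonoidHom.mem_ker, hlift, hlift]
    have := (h w.length w [] le_rfl (Nat.zero_le _)).1
    simpa [ev] using this
  refine ⟨(QuotientGroup.quotientKerEquivOfSurjective _ (hsurj M)).symm.trans
    ((QuotientGroup.quotientMulEquivOfEq hker).trans
      (QuotientGroup.quotientKerEquivOfSurjective _ (hsurj M'))), fun i => ?_⟩
  have h1 : (QuotientGroup.quotientKerEquivOfSurjective _ (hsurj M)).symm (M.gen i) =
      ((FreeGroup.of i : FreeGroup (Fin d)) : FreeGroup (Fin d) ⧸ (FreeGroup.lift M.gen).ker) := by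
    rw [MulEquiv.symm_apply_eq]
    exact (FreeGroup.lift_apply_of (f := M.gen) (x := i)).symm
  simp only [MulEquiv.trans_apply, h1]
  exact FreeGroup.lift_apply_of

theorem natCast_le_radius_iff (M M' : MarkedGroup.{u} d) (k : ℕ) :
    (k : ℕ∞) ≤ radius M M' ↔ k = 0 ∨ Agree M M' k := by
  constructor
  · intro h
    by_contra! hk
    obtain ⟨hk0, hka⟩ := hk
    have h2 : radius M M' ≤ ((k - 1 : ℕ) : ℕ∞) := by
      refine iSup₂_le fun N hN => ?_
      rw [ballIso_iff_agree] at hN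
      have : N < k := by
        by_contra! hlt
        exact hka (hN.mono hlt)
      exact_mod_cast (by omega : N ≤ k - 1)
    have h3 : k ≤ k - 1 := by exact_mod_cast h.trans h2
    omega
  · rintro (rfl | h)
    · simp
    · exact le_iSup₂_of_le k ((ballIso_iff_agree _ _ _).2 h) le_rfl

theorem radius_le_of_agree {M M' P P' : MarkedGroup.{u} d}
    (h : ∀ k, Agree M M' k → Agree P P' k) : radius M M' ≤ radius P P' := by
  rw [← ENat.forall_natCast_le_iff_le]
  intro k hk
  rw [natCast_le_radius_iff] at hk ⊢
  exact hk.imp_right (h k)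

theorem radius_comm (M M' : MarkedGroup.{u} d) : radius M M' = radius M' M :=
  le_antisymm (radius_le_of_agree fun _ h => h.symm) (radius_le_of_agree fun _ h => h.symm)

theorem radius_congr {M M' P P' : MarkedGroup.{u} d} (h : Iso M P) (h' : Iso M' P') :
    radius M M' = radius P P' :=
  le_antisymm
    (radius_le_of_agree fun k hk => ((h.agree k).symm.trans hk).trans (h'.agree k))
    (radius_le_of_agree fun k hk => ((h.agree k).trans hk).trans (h'.agree k).symm)

theorem min_radius_le (M M' M'' : MarkedGroup.{u} d) :
    min (radius M M') (radius M' M'') ≤ radius M M'' := by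
  rw [← ENat.forall_natCast_le_iff_le]
  intro k hk
  rw [le_min_iff, natCast_le_radius_iff, natCast_le_radius_iff] at hk
  rw [natCast_le_radius_iff]
  rcases hk with ⟨h | h, h' | h'⟩
  · exact Or.inl h
  · exact Or.inl h
  · exact Or.inl h'
  · exact Or.inr (h.trans h')

theorem radius_eq_top_iff (M M' : MarkedGroup.{u} d) : radius M M' = ⊤ ↔ Iso M M' := by
  constructor
  · intro h
    refine iso_of_agree fun N => ?_
    have h1 : ((N + 1 : ℕ) : ℕ∞) ≤ radius M M' := by rw [h]; exact le_top
    rw [natCast_le_radius_iff] at h1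
    rcases h1 with h1 | h1
    · omega
    · exact h1.mono (Nat.le_succ N)
  · intro h
    rw [← top_le_iff, ← ENat.forall_natCast_le_iff_le]
    intro k _
    rw [natCast_le_radius_iff]
    exact Or.inr (h.agree k)

theorem twoPowNeg_nonneg (N : ℕ∞) : 0 ≤ twoPowNeg N := by
  unfold twoPowNeg
  split_ifs <;> positivity

theorem twoPowNeg_eq_zero {N : ℕ∞} (h : twoPowNeg N = 0) : N = ⊤ := by
  by_contra hN
  rw [twoPowNeg, if_neg hN] at h
  exact absurd h (by positivity)

theorem twoPowNeg_anti {N N' : ℕ∞} (h : N ≤ N') : twoPowNeg N' ≤ twoPowNeg N := by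
  by_cases h' : N' = ⊤
  · rw [h', twoPowNeg, if_pos rfl]
    exact twoPowNeg_nonneg N
  · have hN : N ≠ ⊤ := fun hN => h' (top_le_iff.1 (hN ▸ h))
    rw [twoPowNeg, twoPowNeg, if_neg h', if_neg hN]
    exact pow_le_pow_of_le_one (by norm_num) (by norm_num) (ENat.toNat_le_toNat h h')

/-- Isomorphism of marked groups, as an equivalence relation. -/
instance setoid (d : ℕ) : Setoid (MarkedGroup.{u} d) where
  r := Iso
  iseqv := ⟨Iso.refl, Iso.symm, Iso.trans⟩

end MarkedGroup

/-- The space `X_d` of marked groups on `d` generators: the set of isomorphism classes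
`[Γ, S]`. -/
def MarkedGroupSpace (d : ℕ) : Type (u + 1) :=
  Quotient (MarkedGroup.setoid.{u} d)

namespace MarkedGroupSpace

/-- The class `[Γ, S]` in `X_d`. -/
def mk {d : ℕ} (Γ : Type u) [Group Γ] (S : Fin d → Γ)
    (hS : Subgroup.closure (Set.range S) = ⊤) : MarkedGroupSpace.{u} d :=
  Quotient.mk (MarkedGroup.setoid.{u} d) { carrier := Γ, gen := S, closure_gen := hS }

/-- The distance `2 ^ (-N)`, where `N ≤ ∞` is the largest radius such that the balls of radius `N`
around the origin in the two Cayley graphs are isomorphic. -/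
noncomputable instance (d : ℕ) : Dist (MarkedGroupSpace.{u} d) where
  dist := Quotient.lift₂ (fun M M' => MarkedGroup.twoPowNeg (MarkedGroup.radius M M'))
    fun _ _ _ _ h h' => congrArg MarkedGroup.twoPowNeg (MarkedGroup.radius_congr h h')

/-- `X_d` as a metric space. -/
noncomputable instance (d : ℕ) : MetricSpace (MarkedGroupSpace.{u} d) where
  dist_self x := by
    induction x using Quotient.ind with | _ M
    change MarkedGroup.twoPowNeg (MarkedGroup.radius M M) = 0
    rw [(MarkedGroup.radius_eq_top_iff M M).2 (MarkedGroup.Iso.refl M), MarkedGroup.twoPowNeg,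
      if_pos rfl]
  dist_comm x y := by
    induction x using Quotient.ind with | _ M
    induction y using Quotient.ind with | _ M'
    change MarkedGroup.twoPowNeg (MarkedGroup.radius M M') =
      MarkedGroup.twoPowNeg (MarkedGroup.radius M' M)
    rw [MarkedGroup.radius_comm]
  dist_triangle x y z := by
    induction x using Quotient.ind with | _ M
    induction y using Quotient.ind with | _ M'
    induction z using Quotient.ind with | _ M''
    change MarkedGroup.twoPowNeg (MarkedGroup.radius M M'') ≤
      MarkedGroup.twoPowNeg (MarkedGroup.radius M M') +
      MarkedGroup.twoPowNeg (MarkedGroup.radius M' M'')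
    have h := MarkedGroup.twoPowNeg_anti (MarkedGroup.min_radius_le M M' M'')
    have h1 := MarkedGroup.twoPowNeg_nonneg (MarkedGroup.radius M M')
    have h2 := MarkedGroup.twoPowNeg_nonneg (MarkedGroup.radius M' M'')
    rcases min_choice (MarkedGroup.radius M M') (MarkedGroup.radius M' M'') with h3 | h3 <;>
      rw [h3] at h <;> linarith
  eq_of_dist_eq_zero := by
    intro x y h
    induction x using Quotient.ind with | _ M
    induction y using Quotient.ind with | _ M'
    exact Quotient.sound ((MarkedGroup.radius_eq_top_iff M M').1 (MarkedGroup.twoPowNeg_eq_zero h))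

end MarkedGroupSpace

/-- The images of generators under a surjective homomorphism are generators. -/
theorem closure_range_comp_eq_top {d : ℕ} {G : Type v} [Group G] {H : Type u} [Group H]
    (φ : G →* H) (hφ : Function.Surjective φ) {S : Fin d → G}
    (hS : Subgroup.closure (Set.range S) = ⊤) :
    Subgroup.closure (Set.range (φ ∘ S)) = ⊤ := by
  rw [Set.range_comp, ← MonoidHom.map_closure, hS, ← MonoidHom.range_eq_map,
    MonoidHom.range_eq_top.2 hφ]

/-! ## The convolution algebra `L¹(Γ)` -/

/-- `L¹(Γ)`: formal series `∑ f_γ γ` with `∑ |f_γ| < ∞`. -/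
abbrev GroupL1 (Γ : Type u) : Type u := lp (fun _ : Γ => ℂ) 1

namespace GroupL1

theorem memℓp_one_iff {Γ : Type u} {f : Γ → ℂ} :
    Memℓp f 1 ↔ Summable fun γ => ‖f γ‖ := by
  rw [memℓp_gen_iff (by simp)]
  simp

theorem summable_norm {Γ : Type u} (f : GroupL1 Γ) : Summable fun γ => ‖f γ‖ :=
  memℓp_one_iff.1 f.2

section

variable {Γ : Type u} [Group Γ]

theorem summable_mul (f g : GroupL1 Γ) :
    Summable fun p : Γ × Γ => ‖f p.2 * g (p.2⁻¹ * p.1)‖ := by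
  have h : Summable fun p : Γ × Γ => ‖f p.1‖ * ‖g p.2‖ :=
    f.summable_norm.mul_of_nonneg g.summable_norm (fun _ => norm_nonneg _) fun _ => norm_nonneg _
  let e : Γ × Γ ≃ Γ × Γ :=
    { toFun := fun p => (p.2, p.2⁻¹ * p.1)
      invFun := fun q => (q.1 * q.2, q.1)
      left_inv := fun p => by simp
      right_inv := fun q => by simp }
  have h2 := e.summable_iff.2 h
  refine h2.congr fun p => ?_
  simp [e]

/-- Multiplication (convolution) in `L¹(Γ)`:
`(∑ f_γ γ) (∑ g_γ γ) = ∑_γ (∑_δ f_δ g_{δ⁻¹ γ}) γ`. -/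
noncomputable def conv (f g : GroupL1 Γ) : GroupL1 Γ :=
  ⟨fun γ => ∑' δ : Γ, f δ * g (δ⁻¹ * γ), memℓp_one_iff.2 (by
    have h := (summable_mul f g).of_norm.norm
    have h1 := h.prod
    refine Summable.of_nonneg_of_le (fun _ => norm_nonneg _) (fun γ => ?_) h1
    exact norm_tsum_le_tsum_norm ((h.prod_factor γ)))⟩

open Classical in
/-- The unit element `e` of `L¹(Γ)`. -/
noncomputable def unit : GroupL1 Γ := lp.single 1 (1 : Γ) (1 : ℂ)

/-- Invertibility in the algebra `L¹(Γ)`. -/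
def IsInvertible (f : GroupL1 Γ) : Prop :=
  ∃ g : GroupL1 Γ, conv f g = unit ∧ conv g f = unit

end

/-- Integration along the fibres: `φ_* (∑ f_γ γ) = ∑ f_γ φ(γ)`. -/
noncomputable def map {Γ : Type u} {Γ' : Type v} [Group Γ] [Group Γ'] (φ : Γ →* Γ')
    (f : GroupL1 Γ) : GroupL1 Γ' :=
  ⟨fun γ' => ∑' γ : φ ⁻¹' {γ'}, f γ, memℓp_one_iff.2 (by
    have h := (Equiv.sigmaFiberEquiv φ).summable_iff.2 f.summable_norm
    refine Summable.of_nonneg_of_le (fun _ => norm_nonneg _) (fun γ' => ?_) h.sigma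
    exact norm_tsum_le_tsum_norm (f.summable_norm.subtype _))⟩

end GroupL1

/-! ## The group von Neumann algebra -/

/-- The Hilbert space `L²(Γ)`: formal series `∑ x_γ γ` with `∑ |x_γ|² < ∞`. -/
def GroupL2 (Γ : Type u) : Type u := lp (fun _ : Γ => ℂ) 2

namespace GroupL2

noncomputable instance (Γ : Type u) : NormedAddCommGroup (GroupL2 Γ) :=
  inferInstanceAs (NormedAddCommGroup (lp (fun _ : Γ => ℂ) 2))

noncomputable instance (Γ : Type u) : InnerProductSpace ℂ (GroupL2 Γ) :=
  inferInstanceAs (InnerProductSpace ℂ (lp (fun _ : Γ => ℂ) 2))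

instance (Γ : Type u) : CompleteSpace (GroupL2 Γ) :=
  inferInstanceAs (CompleteSpace (lp (fun _ : Γ => ℂ) 2))

variable {Γ : Type u}

/-- The coefficient `x_γ` of `x = ∑ x_γ γ`. -/
def coeff (x : GroupL2 Γ) (γ : Γ) : ℂ := x.1 γ

theorem ext_coeff {x y : GroupL2 Γ} (h : ∀ γ, coeff x γ = coeff y γ) : x = y :=
  lp.ext (funext h)

theorem inner_eq_tsum (x y : GroupL2 Γ) :
    inner ℂ x y = ∑' γ, inner ℂ (coeff x γ) (coeff y γ) :=
  lp.inner_eq_tsum (𝕜 := ℂ) (G := fun _ : Γ => ℂ) x y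

theorem memℓp_two_iff {x : Γ → ℂ} : Memℓp x 2 ↔ Summable fun γ => ‖x γ‖ ^ (2 : ℝ) := by
  rw [memℓp_gen_iff (by simp)]
  simp

theorem norm_eq (x : GroupL2 Γ) :
    ‖x‖ = (∑' γ, ‖coeff x γ‖ ^ (2 : ENNReal).toReal) ^ (1 / (2 : ENNReal).toReal) :=
  lp.norm_eq_tsum_rpow (E := fun _ : Γ => ℂ) (p := 2) (by simp) x

/-- Reindexing along a permutation of `Γ`, as a linear isometry of `L²(Γ)`. -/
noncomputable def perm (e : Γ ≃ Γ) : GroupL2 Γ →ₗᵢ[ℂ] GroupL2 Γ where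
  toFun x := (⟨fun γ => coeff x (e γ),
    memℓp_two_iff.2 (e.summable_iff.2 (memℓp_two_iff.1 x.2))⟩ : lp (fun _ : Γ => ℂ) 2)
  map_add' x y := rfl
  map_smul' c x := rfl
  norm_map' x := by
    rw [norm_eq, norm_eq]
    congr 1
    exact e.tsum_eq fun γ => ‖coeff x γ‖ ^ (2 : ENNReal).toReal

variable [Group Γ]

/-- Left multiplication by `γ` on `L²(Γ)`: `∑ x_δ δ ↦ ∑ x_δ (γ δ)`. -/
noncomputable def left (γ : Γ) : GroupL2 Γ →L[ℂ] GroupL2 Γ :=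
  (perm (Equiv.mulLeft γ⁻¹)).toContinuousLinearMap

/-- Right multiplication by `γ` on `L²(Γ)`: `∑ x_δ δ ↦ ∑ x_δ (δ γ)`. -/
noncomputable def right (γ : Γ) : GroupL2 Γ →L[ℂ] GroupL2 Γ :=
  (perm (Equiv.mulRight γ⁻¹)).toContinuousLinearMap

theorem coeff_left (γ : Γ) (x : GroupL2 Γ) (δ : Γ) :
    coeff (left γ x) δ = coeff x (γ⁻¹ * δ) := rfl

theorem coeff_right (γ : Γ) (x : GroupL2 Γ) (δ : Γ) :
    coeff (right γ x) δ = coeff x (δ * γ⁻¹) := rfl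

theorem right_mul_left (γ δ : Γ) : right γ * left δ = left δ * right γ := by
  refine ContinuousLinearMap.ext fun x => ext_coeff fun g => ?_
  change coeff (right γ (left δ x)) g = coeff (left δ (right γ x)) g
  rw [coeff_right, coeff_left, coeff_left, coeff_right, mul_assoc]

theorem star_left (γ : Γ) : star (left γ) = left γ⁻¹ := by
  rw [ContinuousLinearMap.star_eq_adjoint]
  symm
  rw [ContinuousLinearMap.eq_adjoint_iff]
  intro x y
  rw [inner_eq_tsum, inner_eq_tsum, ← (Equiv.mulLeft γ).tsum_eq fun δ =>
    inner ℂ (coeff x δ) (coeff (left γ y) δ)]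
  refine tsum_congr fun δ => ?_
  simp [coeff_left]

open Classical in
/-- The unit `e ∈ Γ ⊆ L²(Γ)`. -/
noncomputable def unit : GroupL2 Γ := lp.single (E := fun _ : Γ => ℂ) 2 1 1

end GroupL2

/-- The von Neumann algebra `𝒩Γ`: the algebra of the bounded operators on `L²(Γ)` that are left
`Γ`-equivariant. -/
noncomputable def GroupVN (Γ : Type u) [Group Γ] :
    StarSubalgebra ℂ (GroupL2 Γ →L[ℂ] GroupL2 Γ) where
  carrier := {A | ∀ γ : Γ, A * GroupL2.left γ = GroupL2.left γ * A}
  mul_mem' {A B} hA hB γ := by rw [mul_assoc, hB γ, ← mul_assoc, hA γ, mul_assoc]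
  add_mem' {A B} hA hB γ := by rw [add_mul, mul_add, hA γ, hB γ]
  algebraMap_mem' c γ := Algebra.commutes c _
  star_mem' {A} hA γ := by
    have h := congrArg star (hA γ⁻¹)
    rw [star_mul, star_mul, GroupL2.star_left, inv_inv] at h
    exact h.symm

namespace GroupVN

variable {Γ : Type u} [Group Γ]

theorem norm_smul_right_le (f : GroupL1 Γ) (γ : Γ) :
    ‖f γ • GroupL2.right γ⁻¹‖ ≤ ‖f γ‖ := by
  rw [norm_smul]
  exact mul_le_of_le_one_right (norm_nonneg _) (LinearIsometry.norm_toContinuousLinearMap_le _)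

theorem summable_smul_right (f : GroupL1 Γ) :
    Summable fun γ : Γ => f γ • GroupL2.right γ⁻¹ :=
  Summable.of_norm_bounded f.summable_norm (norm_smul_right_le f)

/-- The embedding `r : L¹(Γ) → 𝒩Γ`, `r (∑ f_γ γ) = ∑ f_γ R_{γ⁻¹}` (convergence in operator
norm), where `R_γ` is right multiplication by `γ`. -/
noncomputable def r (f : GroupL1 Γ) : GroupVN Γ :=
  ⟨∑' γ : Γ, f γ • GroupL2.right γ⁻¹, fun δ => by
    rw [← (summable_smul_right f).tsum_mul_right, ← (summable_smul_right f).tsum_mul_left]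
    refine tsum_congr fun γ => ?_
    rw [smul_mul_assoc, mul_smul_comm, GroupL2.right_mul_left]⟩

/-- The canonical trace `τ(A) = (A e, e)` (Mathlib's inner product is linear in the second
argument). -/
noncomputable def trace (A : GroupVN Γ) : ℂ :=
  inner ℂ (GroupL2.unit : GroupL2 Γ) ((A : GroupL2 Γ →L[ℂ] GroupL2 Γ) GroupL2.unit)

/-- `|A| = (A* A)^{1/2}`, by functional calculus. -/
noncomputable def abs (A : GroupVN Γ) : GroupVN Γ :=
  ⟨CFC.abs (A : GroupL2 Γ →L[ℂ] GroupL2 Γ), fun γ =>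
    Commute.cfcAbs_left (A.2 γ) (by
      rw [GroupL2.star_left]
      exact A.2 γ⁻¹)⟩

/-- `log A`, by functional calculus. -/
noncomputable def log (A : GroupVN Γ) : GroupVN Γ :=
  ⟨CFC.log (A : GroupL2 Γ →L[ℂ] GroupL2 Γ), fun γ => Commute.cfc_real (A.2 γ) Real.log⟩

/-- `exp τ(log |A|)`, the Fuglede–Kadison determinant of an invertible `A`; the number
`τ(log |A|)` is real because `log |A|` is self-adjoint. -/
noncomputable def detInvertible (A : GroupVN Γ) : ℝ :=
  Real.exp (trace (log (abs A))).re

open Classical in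
/-- The Fuglede–Kadison determinant on `𝒩Γ`: `exp τ(log |A|)` if `A` is invertible, and
`lim_{ε → 0+} det(|A| + ε)` in general. -/
noncomputable def det (A : GroupVN Γ) : ℝ :=
  if IsUnit A then detInvertible A
  else limUnder (𝓝[>] (0 : ℝ)) fun ε : ℝ =>
    detInvertible (abs A + algebraMap ℂ (GroupVN Γ) (ε : ℂ))

end GroupVN

/-! ### Convergence in `X_d` read on kernels. -/

namespace MarkedGroup

variable {d : ℕ}

/-! Only one consequence of convergence in `X_d` is used: each fixed element of the common cover is
a word, and large balls decide whether that word is trivial, so its membership in the kernels is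
eventually that of the limit (`eventually_map_eq_one_iff`). The trace of the image of an `L¹`-series
is the sum of its coefficients over the kernel (`vecState_rep`), so dominated convergence yields
(a).

For (b), everything is pulled back to the cover: a homomorphism `φ` induces a *-representation `rep
φ` of `L¹`, bounded by the `L¹`-norm whatever `φ` is. If `f` has inverse `g`, the spectra of all the
operators `A* A` with `A = rep φ f` lie in a single compact interval of positive reals, determined
by the norms of `f` and `g`. The moments of `A* A` are traces of `L¹`-elements, hence converge by
(a). Weierstrass approximation on that interval then gives convergence of the trace of `log (A* A)`,
which is twice the logarithm of the determinant (`tendsto_vecState_cfc`, `det_eq_exp`). -/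

theorem natCast_le_radius_of_twoPowNeg_lt {M M' : MarkedGroup.{u} d} {k : ℕ}
    (h : twoPowNeg (radius M M') < (1 / 2 : ℝ) ^ k) : (k : ℕ∞) ≤ radius M M' := by
  by_contra! hk
  have h1 := twoPowNeg_anti hk.le
  rw [twoPowNeg, if_neg (ENat.natCast_ne_top k), ENat.toNat_natCast] at h1
  exact absurd h (not_lt.2 h1)

theorem ev_comp {G : Type v} [Group G] {H : Type u} [Group H] (φ : G →* H) (S : Fin d → G)
    (hS : Subgroup.closure (Set.range (φ ∘ S)) = ⊤) (w : List (Fin d × Bool)) :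
    ev { carrier := H, gen := φ ∘ S, closure_gen := hS } w =
      φ (FreeGroup.lift S (FreeGroup.mk w)) := by
  rw [FreeGroup.lift_mk, ev, map_list_prod, List.map_map]
  congr 1
  apply List.map_congr_left
  rintro ⟨i, b⟩ -
  cases b <;> simp

end MarkedGroup

namespace MarkedGroupSpace

/-- In a convergent sequence of marked quotients of a group, every element of that group
eventually lies in the kernel exactly when it lies in the kernel of the limit. -/
theorem eventually_map_eq_one_iff {d : ℕ} {G : Type v} [Group G] {Γ : Type u} [Group Γ]
    {Γn : ℕ → Type u} [∀ n, Group (Γn n)]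
    (φ : G →* Γ) (hφ : Function.Surjective φ)
    (φn : ∀ n, G →* Γn n) (hφn : ∀ n, Function.Surjective (φn n))
    (S : Fin d → G) (hS : Subgroup.closure (Set.range S) = ⊤)
    (hconv : Tendsto
      (fun n => MarkedGroupSpace.mk (Γn n) (φn n ∘ S)
        (closure_range_comp_eq_top (φn n) (hφn n) hS))
      atTop
      (𝓝 (MarkedGroupSpace.mk Γ (φ ∘ S) (closure_range_comp_eq_top φ hφ hS)))) (γ : G) :
    ∀ᶠ n in atTop, (φn n γ = 1 ↔ φ γ = 1) := by
  obtain ⟨x, rfl⟩ : ∃ x, FreeGroup.lift S x = γ := by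
    have : Function.Surjective (FreeGroup.lift S) := by
      rw [← MonoidHom.range_eq_top, FreeGroup.range_lift_eq_closure, hS]
    exact this γ
  obtain ⟨w, rfl⟩ : ∃ w, FreeGroup.mk w = x := ⟨x.toWord, FreeGroup.mk_toWord⟩
  -- The extra 1 keeps the radius nonzero when `w` is empty: a radius of at least 0 carries no
  -- information about balls.
  filter_upwards [(Metric.tendsto_nhds.1 hconv) ((1 / 2 : ℝ) ^ (w.length + 1)) (by positivity)]
    with n hn
  have h := MarkedGroup.natCast_le_radius_of_twoPowNeg_lt hn
  rw [MarkedGroup.natCast_le_radius_iff] at h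
  -- Comparison with the empty word turns agreement of balls into agreement of relations.
  have h1 := ((h.resolve_left (Nat.succ_ne_zero _)) w [] (Nat.le_succ _) (Nat.zero_le _)).1
  rw [MarkedGroup.ev_comp, MarkedGroup.ev_comp, MarkedGroup.ev_comp, MarkedGroup.ev_comp] at h1
  simpa [← FreeGroup.one_eq_mk] using h1

end MarkedGroupSpace

/-! ### Right translations and the vector state at the unit. -/

namespace GroupL2

variable {Γ : Type u}

theorem norm_right_le [Group Γ] (γ : Γ) : ‖right γ‖ ≤ 1 :=
  LinearIsometry.norm_toContinuousLinearMap_le _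

variable [Group Γ]

/-- The order reverses, which is why `L¹` acts through inverses: `γ ↦ right γ⁻¹` is multiplicative.
-/
theorem right_mul_right (γ δ : Γ) : right γ * right δ = right (δ * γ) := by
  refine ContinuousLinearMap.ext fun x => ext_coeff fun g => ?_
  change coeff (right γ (right δ x)) g = _
  simp only [coeff_right, mul_inv_rev, mul_assoc]

theorem right_one : right (1 : Γ) = 1 := by
  refine ContinuousLinearMap.ext fun x => ext_coeff fun g => ?_
  rw [coeff_right, inv_one, mul_one]
  rfl

theorem star_right (γ : Γ) : star (right γ) = right γ⁻¹ := by
  rw [ContinuousLinearMap.star_eq_adjoint]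
  symm
  rw [ContinuousLinearMap.eq_adjoint_iff]
  intro x y
  rw [inner_eq_tsum, inner_eq_tsum, ← (Equiv.mulRight γ).tsum_eq fun δ =>
    inner ℂ (coeff x δ) (coeff (right γ y) δ)]
  refine tsum_congr fun δ => ?_
  simp [coeff_right]

open Classical in
theorem coeff_unit (γ : Γ) : coeff (unit : GroupL2 Γ) γ = if γ = 1 then 1 else 0 := by
  have h : coeff (unit : GroupL2 Γ) γ = Pi.single (M := fun _ : Γ => ℂ) 1 1 γ := rfl
  rw [h, Pi.single_apply]

theorem norm_unit : ‖(unit : GroupL2 Γ)‖ = 1 := by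
  rw [norm_eq, tsum_eq_single 1]
  · simp [coeff_unit]
  · intro γ hγ
    simp [coeff_unit, hγ]

theorem inner_unit (x : GroupL2 Γ) : inner ℂ unit x = coeff x 1 := by
  rw [inner_eq_tsum, tsum_eq_single 1]
  · simp [coeff_unit]
  · intro γ hγ
    simp [coeff_unit, hγ]

instance : Nontrivial (GroupL2 Γ) :=
  ⟨⟨unit, 0, fun h => by simpa [h] using norm_unit (Γ := Γ)⟩⟩

/-- The vector state `A ↦ (A e, e)` on the bounded operators on `L²(Γ)`. -/
noncomputable def vecState (Γ : Type u) [Group Γ] : (GroupL2 Γ →L[ℂ] GroupL2 Γ) →L[ℂ] ℂ :=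
  (innerSL ℂ unit).comp (ContinuousLinearMap.apply ℂ (GroupL2 Γ) unit)

theorem vecState_apply (A : GroupL2 Γ →L[ℂ] GroupL2 Γ) :
    vecState Γ A = inner ℂ unit (A unit) := rfl

theorem norm_vecState_le (A : GroupL2 Γ →L[ℂ] GroupL2 Γ) : ‖vecState Γ A‖ ≤ ‖A‖ := by
  rw [vecState_apply]
  refine (norm_inner_le_norm _ _).trans ?_
  rw [norm_unit, one_mul]
  simpa [norm_unit] using A.le_opNorm unit

open Classical in
theorem vecState_right (γ : Γ) : vecState Γ (right γ⁻¹) = if γ = 1 then 1 else 0 := by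
  rw [vecState_apply, inner_unit, coeff_right, coeff_unit]
  simp

end GroupL2

/-! ### The *-representation of `L¹` of the cover on `L²` of a quotient. -/

namespace GroupL1

variable {G : Type v} [Group G] {Γ : Type u} [Group Γ]

/-- The involution `f* = ∑ conj (f_γ) γ⁻¹` of `L¹`. -/
noncomputable def adj (f : GroupL1 G) : GroupL1 G :=
  ⟨fun γ => star (f γ⁻¹), memℓp_one_iff.2 (by
    simpa [Function.comp_def] using (Equiv.inv G).summable_iff.2 f.summable_norm)⟩

/-- Convolution powers. -/
noncomputable def convPow (f : GroupL1 G) : ℕ → GroupL1 G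
  | 0 => unit
  | k + 1 => conv (convPow f k) f

open GroupL2

/-- The representation of `L¹(G)` on `L²(Γ)` induced by `φ : G → Γ`. -/
noncomputable def rep (φ : G →* Γ) (f : GroupL1 G) : GroupL2 Γ →L[ℂ] GroupL2 Γ :=
  ∑' γ : G, f γ • right (φ γ)⁻¹

theorem norm_smul_right_le (φ : G →* Γ) (f : GroupL1 G) (γ : G) :
    ‖f γ • right (φ γ)⁻¹‖ ≤ ‖f γ‖ := by
  rw [norm_smul]
  exact mul_le_of_le_one_right (norm_nonneg _) (norm_right_le _)

theorem summable_norm_rep (φ : G →* Γ) (f : GroupL1 G) :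
    Summable fun γ : G => ‖f γ • right (φ γ)⁻¹‖ :=
  .of_nonneg_of_le (fun _ => norm_nonneg _) (norm_smul_right_le φ f) f.summable_norm

/-- Right translations are contractions. The bound is independent of `φ`, hence uniform along a
sequence of quotients. -/
theorem norm_rep_le (φ : G →* Γ) (f : GroupL1 G) : ‖rep φ f‖ ≤ ∑' γ, ‖f γ‖ :=
  (norm_tsum_le_tsum_norm (summable_norm_rep φ f)).trans
    ((summable_norm_rep φ f).tsum_le_tsum (norm_smul_right_le φ f) f.summable_norm)

/-- An absolutely convergent sum over `G` may be regrouped along the fibres of `φ`. -/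
theorem coe_r_map (φ : G →* Γ) (f : GroupL1 G) :
    (GroupVN.r (map φ f) : GroupL2 Γ →L[ℂ] GroupL2 Γ) = rep φ f := by
  have h := (Equiv.sigmaFiberEquiv φ).summable_iff.2 (summable_norm_rep φ f).of_norm
  rw [rep, ← (Equiv.sigmaFiberEquiv φ).tsum_eq]
  refine Eq.trans ?_ h.tsum_sigma.symm
  refine tsum_congr fun γ => ?_
  have h1 : Summable fun x : φ ⁻¹' {γ} => f x := f.summable_norm.of_norm.subtype _
  change (∑' x : φ ⁻¹' {γ}, f x) • right γ⁻¹ = _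
  rw [← h1.tsum_smul_const]
  refine tsum_congr fun x => ?_
  change f x.1 • right γ⁻¹ = f x.1 • right (φ x.1)⁻¹
  rw [show φ x.1 = γ from x.2]

theorem rep_unit (φ : G →* Γ) : rep φ (unit : GroupL1 G) = 1 := by
  classical
  have hu : ∀ γ, (unit : GroupL1 G) γ = if γ = 1 then 1 else 0 := by
    intro γ
    have h : (unit : GroupL1 G) γ = Pi.single (M := fun _ : G => ℂ) 1 1 γ := by
      unfold unit
      rw [lp.coeFn_single]
    rw [h, Pi.single_apply]
  rw [rep, tsum_eq_single 1]
  · simp [hu, right_one]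
  · intro γ hγ
    simp [hu, hγ]

theorem rep_conv (φ : G →* Γ) (f g : GroupL1 G) : rep φ (conv f g) = rep φ f * rep φ g := by
  have hs := (summable_mul f g).of_norm
  -- Both sides are the sum of `F` over `G × G`: iterated for the convolution, and reindexed by `e`
  -- for the product. Absolute summability permits both rearrangements.
  let F : G × G → GroupL2 Γ →L[ℂ] GroupL2 Γ := fun p =>
    (f p.2 * g (p.2⁻¹ * p.1)) • right (φ p.1)⁻¹
  have hF : Summable F := by
    refine Summable.of_norm_bounded (summable_mul f g) fun p => ?_
    rw [norm_smul]
    exact mul_le_of_le_one_right (norm_nonneg _) (norm_right_le _)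
  let e : G × G ≃ G × G :=
    { toFun := fun q => (q.1 * q.2, q.1)
      invFun := fun p => (p.2, p.2⁻¹ * p.1)
      left_inv := fun p => by simp
      right_inv := fun q => by simp }
  rw [rep, rep, rep, tsum_mul_tsum_of_summable_norm (summable_norm_rep φ f)
    (summable_norm_rep φ g)]
  calc ∑' γ, (conv f g) γ • right (φ γ)⁻¹
      = ∑' γ, ∑' δ, F (γ, δ) := by
        refine tsum_congr fun γ => ?_
        exact ((hs.prod_factor γ).tsum_smul_const _).symm
    _ = ∑' p, F p := hF.tsum_prod.symm
    _ = ∑' q, F (e q) := (e.tsum_eq F).symm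
    _ = _ := by
        refine tsum_congr fun q => ?_
        simp only [F, e, Equiv.coe_fn_mk, inv_mul_cancel_left, smul_mul_smul_comm,
          right_mul_right, map_mul, mul_inv_rev]

theorem rep_adj (φ : G →* Γ) (f : GroupL1 G) : rep φ (adj f) = star (rep φ f) := by
  rw [rep, rep, tsum_star, ← (Equiv.inv G).tsum_eq]
  refine tsum_congr fun γ => ?_
  rw [star_smul, star_right, Equiv.inv_apply, map_inv]
  simp [adj]

theorem rep_convPow (φ : G →* Γ) (f : GroupL1 G) (k : ℕ) :
    rep φ (convPow f k) = rep φ f ^ k := by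
  induction k with
  | zero => rw [convPow, rep_unit, pow_zero]
  | succ k ih => rw [convPow, rep_conv, ih, pow_succ]

open Classical in
-- The state is continuous and sees only the translations by the identity, so `Γ` enters only
-- through the kernel of `φ`.
theorem vecState_rep (φ : G →* Γ) (f : GroupL1 G) :
    vecState Γ (rep φ f) = ∑' γ, if φ γ = 1 then f γ else 0 := by
  rw [rep, ContinuousLinearMap.map_tsum _ (summable_norm_rep φ f).of_norm]
  refine tsum_congr fun γ => ?_
  rw [map_smul, vecState_right]
  simp

/-- Traces of `L¹`-elements converge as soon as the kernels converge pointwise. -/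
theorem tendsto_vecState_rep {Γn : ℕ → Type u} [∀ n, Group (Γn n)] {φ : G →* Γ}
    {φn : ∀ n, G →* Γn n} (h : ∀ γ, ∀ᶠ n in atTop, (φn n γ = 1 ↔ φ γ = 1)) (f : GroupL1 G) :
    Tendsto (fun n => vecState (Γn n) (rep (φn n) f)) atTop (𝓝 (vecState Γ (rep φ f))) := by
  classical
  simp only [vecState_rep]
  refine tendsto_tsum_of_dominated_convergence f.summable_norm (fun γ => ?_) ?_
  · refine tendsto_nhds_of_eventually_eq ?_
    filter_upwards [h γ] with n hn
    simp only [hn]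
  · refine Eventually.of_forall fun n γ => ?_
    split_ifs <;> simp

end GroupL1

/-! ### From moments to functional calculus. -/

namespace GroupL2

/-- Convergence of moments implies convergence of continuous functions of self-adjoint operators
with uniformly bounded spectrum. -/
theorem tendsto_vecState_cfc {Γ : Type u} [Group Γ] {Γn : ℕ → Type u} [∀ n, Group (Γn n)]
    {A : GroupL2 Γ →L[ℂ] GroupL2 Γ} {An : ∀ n, GroupL2 (Γn n) →L[ℂ] GroupL2 (Γn n)}
    (hA : IsSelfAdjoint A) (hAn : ∀ n, IsSelfAdjoint (An n)) {a b : ℝ}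
    (hs : spectrum ℝ A ⊆ Set.Icc a b) (hsn : ∀ n, spectrum ℝ (An n) ⊆ Set.Icc a b)
    (hm : ∀ k : ℕ, Tendsto (fun n => vecState (Γn n) (An n ^ k)) atTop
      (𝓝 (vecState Γ (A ^ k))))
    {f : ℝ → ℝ} (hf : ContinuousOn f (Set.Icc a b)) :
    Tendsto (fun n => vecState (Γn n) (cfc f (An n))) atTop (𝓝 (vecState Γ (cfc f A))) := by
  rw [Metric.tendsto_nhds]
  intro ε hε
  obtain ⟨p, hp⟩ := exists_polynomial_near_of_continuousOn a b f hf (ε / 3) (by positivity)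
  -- The error is uniform in the group: the state has norm at most 1, and the functional calculus is
  -- bounded by the supremum over the spectrum.
  have happrox : ∀ {Δ : Type u} [Group Δ] (B : GroupL2 Δ →L[ℂ] GroupL2 Δ), IsSelfAdjoint B →
      spectrum ℝ B ⊆ Set.Icc a b →
      dist (vecState Δ (Polynomial.aeval B p)) (vecState Δ (cfc f B)) ≤ ε / 3 := by
    intro Δ _ B hB hsB
    rw [dist_eq_norm, ← map_sub, ← cfc_polynomial p B hB,
      ← cfc_sub _ _ B (by fun_prop) (hf.mono hsB)]
    refine (norm_vecState_le _).trans (norm_cfc_le (by positivity) fun x hx => ?_)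
    exact (hp x (hsB hx)).le
  have hpoly : Tendsto (fun n => vecState (Γn n) (Polynomial.aeval (An n) p)) atTop
      (𝓝 (vecState Γ (Polynomial.aeval A p))) := by
    simp only [Polynomial.aeval_eq_sum_range, map_sum]
    refine tendsto_finsetSum _ fun k _ => ?_
    have hr : ∀ {Δ : Type u} [Group Δ] (B : GroupL2 Δ →L[ℂ] GroupL2 Δ) (c : ℝ),
        vecState Δ (c • B) = c • vecState Δ B := fun B c =>
      ((vecState _).restrictScalars ℝ).map_smul c B
    simp only [hr]
    exact (hm k).const_smul _
  filter_upwards [(Metric.tendsto_nhds.1 hpoly) (ε / 3) (by positivity)] with n hn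
  have h1 := happrox A hA hs
  have h2 := happrox (An n) (hAn n) (hsn n)
  rw [dist_comm] at h2
  have h3 := dist_triangle4 (vecState (Γn n) (cfc f (An n)))
    (vecState (Γn n) (Polynomial.aeval (An n) p)) (vecState Γ (Polynomial.aeval A p))
    (vecState Γ (cfc f A))
  linarith

end GroupL2

/-- The spectrum of `star A * A` for an invertible element of a C⋆-algebra. -/
theorem spectrum_star_mul_self_subset_Icc {𝓐 : Type*} [CStarAlgebra 𝓐] [Nontrivial 𝓐] {A B : 𝓐}
    (hAB : A * B = 1) (hBA : B * A = 1) {s t : ℝ} (hs : ‖A‖ ≤ s) (ht : ‖B‖ ≤ t) :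
    spectrum ℝ (star A * A) ⊆ Set.Icc (t ^ 2)⁻¹ (s ^ 2) := by
  intro x hx
  -- The inverse of `star A * A` is explicit, so its norm bounds the inverses of spectral values and
  -- gives the lower endpoint.
  let U : 𝓐ˣ := ⟨star A * A, B * star B, by
    rw [mul_assoc, ← mul_assoc A, hAB, one_mul, ← star_mul, hBA, star_one], by
    rw [mul_assoc, ← mul_assoc (star B), ← star_mul, hAB, star_one, one_mul, hBA]⟩
  have hx0 : 0 ≤ x := spectrum_star_mul_self_nonneg x hx
  have hxne : x ≠ 0 := by
    rintro rfl
    exact spectrum.zero_notMem ℝ U.isUnit hx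
  have hinv : x⁻¹ ∈ spectrum ℝ (B * star B) :=
    (spectrum.inv_mem_iff (r := Units.mk0 x hxne) (a := U)).1 hx
  have h1 : x ≤ s ^ 2 := by
    have h := spectrum.norm_le_norm_of_mem hx
    rw [Real.norm_of_nonneg hx0, CStarRing.norm_star_mul_self] at h
    nlinarith [norm_nonneg A]
  have h2 : x⁻¹ ≤ t ^ 2 := by
    have h := spectrum.norm_le_norm_of_mem hinv
    rw [Real.norm_of_nonneg (inv_nonneg.2 hx0), CStarRing.norm_self_mul_star] at h
    nlinarith [norm_nonneg B]
  have hxpos : 0 < x := hx0.lt_of_ne' hxne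
  exact ⟨inv_le_of_inv_le₀ hxpos h2, h1⟩

/-! ### The determinant through `A* A`. -/

namespace GroupVN

open GroupL2 GroupL1

theorem trace_eq_vecState {Γ : Type u} [Group Γ] (A : GroupVN Γ) :
    trace A = vecState Γ (A : GroupL2 Γ →L[ℂ] GroupL2 Γ) := rfl

/-- `2 log |A| = log (A* A)` for invertible `A`. -/
theorem cfc_log_star_mul_self {Γ : Type u} [Group Γ] (A : GroupL2 Γ →L[ℂ] GroupL2 Γ)
    (hA : IsUnit A) : cfc Real.log (star A * A) = 2 • CFC.log (CFC.abs A) := by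
  rw [← CFC.abs_sq, ← CFC.log_pow 2 (CFC.abs A) _ (CFC.abs_nonneg A).isSelfAdjoint]
  · rfl
  · intro x hx h0
    have hu : IsUnit (CFC.abs A) := by
      have h : IsUnit (CFC.abs A ^ 2) := by
        rw [CFC.abs_sq]
        exact hA.star.mul hA
      exact (isUnit_pow_iff two_ne_zero).1 h
    rw [h0] at hx
    exact spectrum.zero_notMem ℝ hu hx

/-- Passing from `|A|` to `A* A` removes the square root: powers of `A* A` again come from `L¹` when
`A` does. -/
theorem det_eq_exp {Γ : Type u} [Group Γ] {A : GroupVN Γ} (hA : IsUnit A) :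
    det A = Real.exp ((vecState Γ (cfc Real.log
      (star (A : GroupL2 Γ →L[ℂ] GroupL2 Γ) * (A : GroupL2 Γ →L[ℂ] GroupL2 Γ)))).re / 2) := by
  rw [det, if_pos hA, detInvertible,
    cfc_log_star_mul_self (A : GroupL2 Γ →L[ℂ] GroupL2 Γ) (hA.map (GroupVN Γ).subtype),
    map_nsmul]
  congr 1
  change (vecState Γ (CFC.log (CFC.abs (A : GroupL2 Γ →L[ℂ] GroupL2 Γ)))).re = _
  simp

theorem isUnit_r_map {G : Type v} [Group G] {Γ : Type u} [Group Γ] (φ : G →* Γ)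
    {f g : GroupL1 G} (hfg : conv f g = GroupL1.unit) (hgf : conv g f = GroupL1.unit) :
    IsUnit (r (map φ f)) :=
  ⟨⟨r (map φ f), r (map φ g),
    Subtype.ext (by
      change (r (map φ f) : GroupL2 Γ →L[ℂ] GroupL2 Γ) * (r (map φ g)) = 1
      rw [coe_r_map, coe_r_map, ← rep_conv, hfg, rep_unit]),
    Subtype.ext (by
      change (r (map φ g) : GroupL2 Γ →L[ℂ] GroupL2 Γ) * (r (map φ f)) = 1
      rw [coe_r_map, coe_r_map, ← rep_conv, hgf, rep_unit])⟩, rfl⟩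

end GroupVN

theorem GroupL1.spectrum_star_rep_mul_rep_subset {G : Type v} [Group G] {Γ : Type u} [Group Γ]
    (φ : G →* Γ) {f g : GroupL1 G} (hfg : conv f g = unit) (hgf : conv g f = unit) :
    spectrum ℝ (star (rep φ f) * rep φ f) ⊆
      Set.Icc ((∑' γ, ‖g γ‖) ^ 2)⁻¹ ((∑' γ, ‖f γ‖) ^ 2) :=
  spectrum_star_mul_self_subset_Icc (by rw [← rep_conv, hfg, rep_unit])
    (by rw [← rep_conv, hgf, rep_unit]) (norm_rep_le φ f) (norm_rep_le φ g)

/-- A right inverse acts on the nonzero space `L²(G)` by a nonzero operator. This makes the lower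
endpoint of the spectral interval positive, since `0⁻¹ = 0` would let in the singularity of the
logarithm. -/
theorem GroupL1.tsum_norm_pos_of_conv_eq_unit {G : Type v} [Group G] {f g : GroupL1 G}
    (hfg : conv f g = unit) : 0 < ∑' γ, ‖g γ‖ := by
  have h : rep (MonoidHom.id G) f * rep (MonoidHom.id G) g = 1 := by
    rw [← rep_conv, hfg, rep_unit]
  have hg : rep (MonoidHom.id G) g ≠ 0 := by
    intro h0
    rw [h0, mul_zero] at h
    exact zero_ne_one h
  exact (norm_pos_iff.2 hg).trans_le (norm_rep_le _ g)

theorem corollary23 {d : ℕ} {Γt : Type v} [Group Γt] {Γ : Type u} [Group Γ]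
    {Γn : ℕ → Type u} [∀ n, Group (Γn n)]
    (φ : Γt →* Γ) (hφ : Function.Surjective φ)
    (φn : ∀ n, Γt →* Γn n) (hφn : ∀ n, Function.Surjective (φn n))
    (St : Fin d → Γt) (hSt : Subgroup.closure (Set.range St) = ⊤)
    (hconv : Tendsto
      (fun n => MarkedGroupSpace.mk (Γn n) (φn n ∘ St)
        (closure_range_comp_eq_top (φn n) (hφn n) hSt))
      atTop
      (𝓝 (MarkedGroupSpace.mk Γ (φ ∘ St) (closure_range_comp_eq_top φ hφ hSt))))
    (ft : GroupL1 Γt) :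
    Tendsto (fun n => GroupVN.trace (GroupVN.r (GroupL1.map (φn n) ft))) atTop
      (𝓝 (GroupVN.trace (GroupVN.r (GroupL1.map φ ft)))) ∧
    (GroupL1.IsInvertible ft →
      Tendsto (fun n => GroupVN.det (GroupVN.r (GroupL1.map (φn n) ft))) atTop
        (𝓝 (GroupVN.det (GroupVN.r (GroupL1.map φ ft))))) := by
  have hker := MarkedGroupSpace.eventually_map_eq_one_iff φ hφ φn hφn St hSt hconv
  refine ⟨?_, ?_⟩
  · simp only [GroupVN.trace_eq_vecState, GroupL1.coe_r_map]
    exact GroupL1.tendsto_vecState_rep hker ft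
  · rintro ⟨g, hfg, hgf⟩
    simp only [GroupVN.det_eq_exp (GroupVN.isUnit_r_map _ hfg hgf), GroupL1.coe_r_map]
    have hpos := GroupL1.tsum_norm_pos_of_conv_eq_unit hfg
    have hlog : ContinuousOn Real.log
        (Set.Icc ((∑' γ, ‖g γ‖) ^ 2)⁻¹ ((∑' γ, ‖ft γ‖) ^ 2)) := by
      refine Real.continuousOn_log.mono fun x hx => ?_
      have h0 : 0 < ((∑' γ, ‖g γ‖) ^ 2)⁻¹ := by positivity
      exact (h0.trans_le hx.1).ne'
    have h := GroupL2.tendsto_vecState_cfc (IsSelfAdjoint.star_mul_self (GroupL1.rep φ ft))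
      (fun n => IsSelfAdjoint.star_mul_self (GroupL1.rep (φn n) ft))
      (GroupL1.spectrum_star_rep_mul_rep_subset φ hfg hgf)
      (fun n => GroupL1.spectrum_star_rep_mul_rep_subset (φn n) hfg hgf) (fun k => ?_) hlog
    · exact (Real.continuous_exp.tendsto _).comp
        (((Complex.continuous_re.tendsto _).comp h).div_const 2)
    -- The `k`-th moment is the trace of the `L¹`-element `(f* f)^k`, formed once in the cover.
    · have hpow := GroupL1.tendsto_vecState_rep hker
        (GroupL1.convPow (GroupL1.conv (GroupL1.adj ft) ft) k)
      simpa only [GroupL1.rep_convPow, GroupL1.rep_conv, GroupL1.rep_adj] using hpow
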